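/- Let $k,l$ be integers with $0<l<k$. Consider the free boson on a circle of radius $R=1/\sqrt{2k}$: the algebraic Fock space $\mathcal F=\bigoplus_{m,n\in\mathbb Z}\mathbb C[a_{-1},a_{-2},\dots,\bar a_{-1},\bar a_{-2},\dots]\,|m,n\rangle$, where $[a_i,a_j]=[\bar a_i,\bar a_j]=i\,\delta_{i+j,0}$, $[a_i,\bar a_j]=0$, $a_i|m,n\rangle=\bar a_i|m,n\rangle=0$ for $i>0$, $a_0|m,n\rangle=\frac{mk+n}{\sqrt{2k}}|m,n\rangle$ and $\bar a_0|m,n\rangle=\frac{mk-n}{\sqrt{2k}}|m,n\rangle$. For $\epsilon=\pm1$ let $J^{\epsilon}_j$ $(j\in\mathbb Z)$ be the modes of the current $J^{\epsilon}(z)=\,:\!e^{\epsilon i\sqrt{2k}\,\phi(z)}\!:$ of weight $k$, i.e. $$\sum_{j\in\mathbb Z}J^{\epsilon}_j z^{-j-k}=\exp\Big(\epsilon\sqrt{2k}\sum_{n>0}\tfrac{a_{-n}}{n}z^{n}\Big)\exp\Big(-\epsilon\sqrt{2k}\sum_{n>0}\tfrac{a_{n}}{n}z^{-n}\Big)\,T^{\epsilon}\,z^{\epsilon\sqrt{2k}\,a_0},$$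 where $T^{\epsilon}$ commutes with the modes $a_n$ $(n\neq0)$ and all $\bar a_n$ $(n\ne 0)$ and maps $|m,n\rangle$ to $|m+\epsilon,n+\epsilon k\rangle$; the $\bar J^{\epsilon}_j$ are defined in the same way from the $\bar a_n$, with the shift $|m,n\rangle\mapsto|m+\epsilon,n-\epsilon k\rangle$. Let $$S=\{a_ia_j,\ J^+_j+J^-_j,\ a_i(J^+_j-J^-_j),\ \bar a_i\bar a_j,\ \bar J^+_j+\bar J^-_j,\ \bar a_i(\bar J^+_j-\bar J^-_j)\;:\;i,j\in\mathbb Z\}.$$ For $m,n\in\mathbb Z$ let $H^U_{m,n}\subset\mathcal F$ be the span of all products of an even number of creation modes ($a_{-i}$, $\bar a_{-i}$ with $i>0$) applied to $|m,n\rangle+|-m,-n\rangle$ and of all products of an odd number of creation modes applied to $|m,n\rangle-|-m,-n\rangle$. Then the subspaces $H^U_{s+s',\,k(s-s')+l}$, $s,s'\in\mathbb Z$, are linearly independent, and the space of all vectors obtained from $|0,l\rangle+|0,-l\rangle$ by the algebra generated by $S$ (linear combinations of products of elements of $S$) is exactly their direct sum $$H_{l^2/4k}=\bigoplus_{s,s'\in\mathbb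 Z}H^U_{s+s',\,k(s-s')+l}.$$ Moreover, with $L_0=\frac12\sum_{n\in\mathbb Z}:\!a_{-n}a_n\!:$ and $\bar L_0$ defined likewise from the $\bar a_n$, the space $H_{l^2/4k}$ is the direct sum of finite-dimensional joint eigenspaces of $L_0$ and $\bar L_0$ with real eigenvalues, and for every real $q$ with $0<q<1$ the trace over it converges and $$\mathrm{Tr}_{H_{l^2/4k}}\big(q^{L_0-1/24}q^{\bar L_0-1/24}\big)=\chi_l(q)^2,\qquad \chi_l(q)=\sum_{n\in\mathbb Z}\frac{q^{k(n+l/2k)^2}}{\eta(q)},\quad \eta(q)=q^{1/24}\prod_{n\ge1}(1-q^n).$$ -/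

import Mathlib

namespace Orbifold

/-- The two chiral halves: `left` for the modes `a_n`, `right` for the modes `ā_n`. -/
inductive Chirality
  | left
  | right

/-- Labels of the occupation number basis: how often each creation mode (a chirality together with
a positive mode number) occurs, and the pair (momentum number `m`, winding number `n`). -/
abbrev Label : Type := ((Chirality × ℕ+) →₀ ℕ) × (ℤ × ℤ)

/-- The algebraic Fock space `⨁_{m,n} ℂ[a_{-1}, a_{-2}, …, ā_{-1}, ā_{-2}, …] |m,n⟩` of the circle
theory, with the monomials in the creation modes applied to the states `|m,n⟩` as a basis. -/
abbrev Fock : Type := Label →₀ ℂ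

/-- The state `|m,n⟩`. -/
noncomputable def ket (m n : ℤ) : Fock := Finsupp.single (0, (m, n)) 1

/-- The real number `√(2k)`, as a complex number. It is `1/R`. -/
noncomputable def rootTwo (k : ℕ) : ℂ := ((Real.sqrt (2 * (k : ℝ)) : ℝ) : ℂ)

/-- `√(2k)` times the zero mode eigenvalue on `|m,n⟩`: `mk + n` (left) and `mk - n` (right). -/
def charge (k : ℕ) : Chirality → ℤ × ℤ → ℤ
  | .left, w => w.1 * k + w.2
  | .right, w => w.1 * k - w.2

/-- The mode `a_j` (left) or `ā_j` (right). Creation modes (`j < 0`) add a quantum, the zero mode is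
`m/(2R) ± nR = (mk ± n)/√(2k)`, and annihilation modes (`j > 0`) are fixed by
`[a_i, a_j] = i δ_{i+j,0}`. -/
noncomputable def osc (k : ℕ) (c : Chirality) : ℤ → Module.End ℂ Fock
  | Int.negSucc n => Finsupp.linearCombination ℂ fun b : Label =>
      Finsupp.single (b.1 + Finsupp.single (c, n.succPNat) 1, b.2) 1
  | Int.ofNat 0 => Finsupp.linearCombination ℂ fun b : Label =>
      Finsupp.single b ((charge k c b.2 : ℂ) / rootTwo k)
  | Int.ofNat (n + 1) => Finsupp.linearCombination ℂ fun b : Label =>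
      Finsupp.single (b.1 - Finsupp.single (c, n.succPNat) 1, b.2)
        (((n + 1) * b.1 (c, n.succPNat) : ℕ) : ℂ)

/-- The coefficient of `z ^ N` in `exp (∑_{n ≥ 1} t_n z ^ n)`; powers `j > N` of the exponent do not
contribute. -/
noncomputable def expCoeff {A : Type*} [Ring A] [Algebra ℂ A] (t : ℕ → A) (N : ℕ) : A :=
  ∑ j ∈ Finset.range (N + 1), ((j.factorial : ℂ)⁻¹) •
    PowerSeries.coeff N ((PowerSeries.mk fun n => if n = 0 then 0 else t n) ^ j)

/-- The charge shift by `ε√(2k)` in one chirality: `|p,p̄⟩ ↦ |p + ε√(2k), p̄⟩` (left) or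
`|p, p̄ + ε√(2k)⟩` (right), where `p = (mk + n)/√(2k)` and `p̄ = (mk - n)/√(2k)`. -/
def shift (k : ℕ) (ε : ℤ) : Chirality → ℤ × ℤ → ℤ × ℤ
  | .left, w => (w.1 + ε, w.2 + ε * k)
  | .right, w => (w.1 + ε, w.2 - ε * k)

/-- The charge shift as an operator on the Fock space. -/
noncomputable def shiftOp (k : ℕ) (ε : ℤ) (c : Chirality) : Module.End ℂ Fock :=
  Finsupp.linearCombination ℂ fun b : Label => Finsupp.single (b.1, shift k ε c b.2) 1

/-- The coefficient of `z ^ N` in `exp (ε√(2k) ∑_{n ≥ 1} a_{-n} z ^ n / n)`. -/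
noncomputable def creationPart (k : ℕ) (ε : ℤ) (c : Chirality) (N : ℕ) : Module.End ℂ Fock :=
  expCoeff (fun n => ((ε : ℂ) * rootTwo k / (n : ℂ)) • osc k c (-(n : ℤ))) N

/-- The coefficient of `z ^ (-M)` in `exp (-ε√(2k) ∑_{n ≥ 1} a_n z ^ (-n) / n)`. -/
noncomputable def annihilationPart (k : ℕ) (ε : ℤ) (c : Chirality) (M : ℕ) : Module.End ℂ Fock :=
  expCoeff (fun n => (-((ε : ℂ) * rootTwo k / (n : ℂ))) • osc k c (n : ℤ)) M

/-- The mode `J^ε_j` of the normally ordered exponential current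
`J^ε(z) = :exp (ε i√(2k) φ(z)): = ∑_j J^ε_j z ^ (-j-k)` of conformal weight `k` (`ε = 1` is `J^+`,
`ε = -1` is `J^-`), that is, the coefficient of `z ^ (-j-k)` in
`exp (ε√(2k) ∑_{n ≥ 1} a_{-n} z ^ n / n) · shift · exp (-ε√(2k) ∑_{n ≥ 1} a_n z ^ (-n) / n) ·
z ^ (ε√(2k) a_0)`. On a basis vector only finitely many pairs `(N, M)` contribute. -/
noncomputable def current (k : ℕ) (c : Chirality) (ε j : ℤ) : Module.End ℂ Fock :=
  Finsupp.linearCombination ℂ fun b : Label =>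
    ∑ᶠ e : ℕ × ℕ,
      if ε * charge k c b.2 + (e.1 : ℤ) - (e.2 : ℤ) = -j - (k : ℤ) then
        creationPart k ε c e.1 (shiftOp k ε c (annihilationPart k ε c e.2 (Finsupp.single b 1)))
      else 0

/-- The set `S`: the operators `a_i a_j`, `J^+_j + J^-_j`, `a_i (J^+_j - J^-_j)` for all integers
`i`, `j`, and their antiholomorphic counterparts. -/
def symmetrySet (k : ℕ) : Set (Module.End ℂ Fock) :=
  {T | ∃ c : Chirality,
    (∃ i j : ℤ, T = osc k c i * osc k c j) ∨
    (∃ j : ℤ, T = current k c 1 j + current k c (-1) j) ∨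
    (∃ i j : ℤ, T = osc k c i * (current k c 1 j - current k c (-1) j))}

/-- The space generated from the state `v` by `S`: all `T v`, where `T` is a linear combination of
(possibly empty) products of elements of `S`. -/
noncomputable def generated (k : ℕ) (v : Fock) : Submodule ℂ Fock :=
  (Subalgebra.toSubmodule (Algebra.adjoin ℂ (symmetrySet k))).map (LinearMap.applyₗ v)

/-- The product `a_{-n_1} ⋯ a_{-n_i} ā_{-n'_1} ⋯ ā_{-n'_j}` of creation modes. -/
noncomputable def creators (k : ℕ) (x y : List ℕ+) : Module.End ℂ Fock :=
  (x.map fun n => osc k .left (-((n : ℕ) : ℤ))).prod *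
    (y.map fun n => osc k .right (-((n : ℕ) : ℤ))).prod

/-- The space `H^U_{mn}`: even products of creation modes on `|m,n⟩ + |-m,-n⟩` together with odd
products of creation modes on `|m,n⟩ - |-m,-n⟩`. -/
noncomputable def untwisted (k : ℕ) (m n : ℤ) : Submodule ℂ Fock :=
  Submodule.span ℂ {v | ∃ x y : List ℕ+, Even (x.length + y.length) ∧
      v = creators k x y (ket m n + ket (-m) (-n))} ⊔
    Submodule.span ℂ {v | ∃ x y : List ℕ+, Odd (x.length + y.length) ∧
      v = creators k x y (ket m n - ket (-m) (-n))}

/-- The summand `H^U_{s+s', k(s-s')+l}`, indexed by the pair `(s, s')`. -/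
noncomputable def summand (k l : ℕ) (s : ℤ × ℤ) : Submodule ℂ Fock :=
  untwisted k (s.1 + s.2) (k * (s.1 - s.2) + l)

/-- The normally ordered product `:a_{-n} a_n:`. -/
noncomputable def normalOrdered (k : ℕ) (c : Chirality) (n : ℤ) : Module.End ℂ Fock :=
  if 0 ≤ n then osc k c (-n) * osc k c n else osc k c n * osc k c (-n)

/-- The Virasoro generator `L_0 = ½ ∑_{n ∈ ℤ} :a_{-n} a_n:` (left), and likewise `L̄_0` (right); on a
basis vector only finitely many `n` contribute. -/
noncomputable def virasoroZero (k : ℕ) (c : Chirality) : Module.End ℂ Fock :=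
  Finsupp.linearCombination ℂ fun b : Label =>
    (1 / 2 : ℂ) • ∑ᶠ n : ℤ, normalOrdered k c n (Finsupp.single b 1)

/-- The vectors in `W` with `L_0 = h` and `L̄_0 = h'`, for `(h, h') = w`. -/
noncomputable def weightSpace (k : ℕ) (W : Submodule ℂ Fock) (w : ℝ × ℝ) : Submodule ℂ Fock :=
  W ⊓ (Module.End.eigenspace (virasoroZero k .left) (w.1 : ℂ) ⊓
    Module.End.eigenspace (virasoroZero k .right) (w.2 : ℂ))

/-- `Tr_W (q^{L_0 - 1/24} q^{L̄_0 - 1/24})` exists and equals `t`: the space `W` is the (automatically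
direct) sum of finite-dimensional joint eigenspaces of `L_0` and `L̄_0` with real eigenvalues, and
the sum of the eigenvalues of `q^{L_0 - 1/24} q^{L̄_0 - 1/24}`, with multiplicities, converges
to `t`. -/
structure HasTrace (k : ℕ) (W : Submodule ℂ Fock) (q t : ℝ) : Prop where
  iSup_weightSpace : ⨆ w : ℝ × ℝ, weightSpace k W w = W
  finite_weightSpace : ∀ w : ℝ × ℝ, Module.Finite ℂ (weightSpace k W w)
  hasSum : HasSum (fun w : ℝ × ℝ => (Module.finrank ℂ (weightSpace k W w) : ℝ) *
    (q ^ (w.1 - 1 / 24) * q ^ (w.2 - 1 / 24))) t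

/-- The Dedekind eta function `η(q) = q^{1/24} ∏_{n ≥ 1} (1 - q^n)`. -/
noncomputable def eta (q : ℝ) : ℝ := q ^ (1 / 24 : ℝ) * ∏' n : ℕ, (1 - q ^ (n + 1))

/-- The character `χ_l(q) = ∑_{n ∈ ℤ} q^{k(n + l/2k)²} / η(q)`. -/
noncomputable def chi (k l : ℕ) (q : ℝ) : ℝ :=
  ∑' n : ℤ, q ^ ((k : ℝ) * ((n : ℝ) + (l : ℝ) / (2 * (k : ℝ))) ^ 2) / eta q

end Orbifold

namespace Orbifold

/-! ### Action of the modes on the occupation number basis -/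

/-! Everything rests on the reflection `parity`, which negates all modes and sends `|m,n⟩` to
`|-m,-n⟩`. It exchanges `J^+` and `J^-`, so every element of `S` commutes with it. The sum of the
spaces `H^U` is the reflection-invariant part of the vectors whose charges lie in the lattice
`position` or its negative (`untwisted_eq_span`, `supported_inf_invariants`). Charge shifts preserve
this set of charges, so the generated space cannot leave that sum (`generated_le_representation`).

Conversely, `0 < l < k` makes both zero modes nonzero on every lattice charge. Hence `a_{-n} a_0`
adds any quantum to a symmetrized basis vector (`symmetrized_add_single_mem_generated`). To change
sector, a suitable `J^+_j + J^-_j` is applied to a symmetrized ground state. One shift direction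
gives the neighbouring ground state, the other an unwanted vector, and `a_0 ^ 2` separates the two
because its eigenvalues differ (`symmetrized_shift_mem_generated`).

The same bounds on `l` keep the lattice disjoint from its negative (`position_ne_neg_position`). So
the summands are independent, and symmetrized vectors indexed by lattice labels form a basis of
weight vectors. The trace is then a sum over occupation numbers and lattice points, which factors
into two inverse Euler products and two theta sums (`hasSum_pow_level`, `hasSum_lattice`). -/

lemma rootTwo_ne_zero {k : ℕ} (hk : 0 < k) : rootTwo k ≠ 0 := by
  have : 0 < (k : ℝ) := by exact_mod_cast hk
  simp only [rootTwo, ne_eq, Complex.ofReal_eq_zero]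
  positivity

lemma rootTwo_sq (k : ℕ) : rootTwo k ^ 2 = 2 * k := by
  rw [rootTwo, ← Complex.ofReal_pow, Real.sq_sqrt (by positivity)]
  push_cast
  rfl

lemma osc_neg_single (k : ℕ) (c : Chirality) (n : ℕ+) (b : Label) (r : ℂ) :
    osc k c (-((n : ℕ) : ℤ)) (Finsupp.single b r) =
      Finsupp.single (b.1 + Finsupp.single (c, n) 1, b.2) r := by
  obtain ⟨n, rfl⟩ : ∃ m : ℕ, n = m.succPNat := ⟨n.natPred, by simp⟩
  have : (-((n.succPNat : ℕ) : ℤ)) = Int.negSucc n := by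
    rw [Nat.succPNat_coe, Int.negSucc_eq]; push_cast; ring
  rw [this]
  simp [osc, Finsupp.linearCombination_single]

lemma osc_zero_single (k : ℕ) (c : Chirality) (b : Label) (r : ℂ) :
    osc k c 0 (Finsupp.single b r) = ((charge k c b.2 : ℂ) / rootTwo k) • Finsupp.single b r := by
  have : (0 : ℤ) = Int.ofNat 0 := rfl
  rw [this]
  simp [osc, Finsupp.linearCombination_single, mul_comm]

lemma osc_pos_single (k : ℕ) (c : Chirality) (n : ℕ+) (b : Label) (r : ℂ) :
    osc k c ((n : ℕ) : ℤ) (Finsupp.single b r) =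
      (((n : ℕ) : ℂ) * b.1 (c, n)) •
        Finsupp.single (b.1 - Finsupp.single (c, n) 1, b.2) r := by
  obtain ⟨n, rfl⟩ : ∃ m : ℕ, n = m.succPNat := ⟨n.natPred, by simp⟩
  have : ((n.succPNat : ℕ) : ℤ) = Int.ofNat (n + 1) := by simp
  rw [this]
  simp only [osc, Finsupp.linearCombination_single, Finsupp.smul_single, smul_eq_mul]
  rw [mul_comm, Nat.succPNat_coe]
  push_cast
  rfl

/-- Every integer is minus a positive integer, zero, or a positive integer. -/
lemma int_mode_cases {P : ℤ → Prop} (neg : ∀ n : ℕ+, P (-((n : ℕ) : ℤ))) (zero : P 0)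
    (pos : ∀ n : ℕ+, P ((n : ℕ) : ℤ)) (j : ℤ) : P j := by
  rcases lt_trichotomy j 0 with h | rfl | h
  · obtain ⟨n, hn⟩ := Int.eq_ofNat_of_zero_le (neg_nonneg.mpr h.le)
    have := neg ⟨n, by omega⟩
    simpa [← hn] using this
  · exact zero
  · obtain ⟨n, hn⟩ := Int.eq_ofNat_of_zero_le h.le
    have := pos ⟨n, by omega⟩
    simpa [← hn] using this

/-! ### Vectors supported in given sectors -/

/-- The vectors with momentum and winding in `A`. -/
noncomputable def sector (A : Set (ℤ × ℤ)) : Submodule ℂ Fock :=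
  Finsupp.supported ℂ ℂ {b : Label | b.2 ∈ A}

lemma single_mem_sector {A : Set (ℤ × ℤ)} {b : Label} (hb : b.2 ∈ A) (r : ℂ) :
    Finsupp.single b r ∈ sector A :=
  Finsupp.single_mem_supported ℂ r hb

lemma map_mem_of_supported {B : Set Label} {T : Module.End ℂ Fock} {W : Submodule ℂ Fock}
    (h : ∀ b ∈ B, T (Finsupp.single b 1) ∈ W) {v : Fock} (hv : v ∈ Finsupp.supported ℂ ℂ B) :
    T v ∈ W := by
  rw [Finsupp.supported_eq_span_single] at hv
  have : Submodule.span ℂ ((fun i ↦ Finsupp.single i (1 : ℂ)) '' B) ≤ W.comap T := by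
    rw [Submodule.span_le]
    rintro _ ⟨b, hb, rfl⟩
    exact h b hb
  exact this hv

lemma map_mem_of_mem_sector {A : Set (ℤ × ℤ)} {T : Module.End ℂ Fock} {W : Submodule ℂ Fock}
    (h : ∀ b : Label, b.2 ∈ A → T (Finsupp.single b 1) ∈ W) {v : Fock} (hv : v ∈ sector A) :
    T v ∈ W :=
  map_mem_of_supported h hv

lemma osc_mem_sector (k : ℕ) (c : Chirality) (j : ℤ) {A : Set (ℤ × ℤ)} {v : Fock}
    (hv : v ∈ sector A) : osc k c j v ∈ sector A := by
  refine map_mem_of_mem_sector (fun b hb => ?_) hv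
  induction j using int_mode_cases with
  | neg n => rw [osc_neg_single]; exact single_mem_sector (by exact hb) _
  | zero => rw [osc_zero_single]; exact Submodule.smul_mem _ _ (single_mem_sector hb _)
  | pos n => rw [osc_pos_single]; exact Submodule.smul_mem _ _ (single_mem_sector (by exact hb) _)

/-! ### Coefficients of exponentials -/

lemma coeff_pow_mem {A : Type*} [Ring A] [Algebra ℂ A] (S : Subalgebra ℂ A) {f : PowerSeries A}
    (hf : ∀ n, PowerSeries.coeff n f ∈ S) (j N : ℕ) : PowerSeries.coeff N (f ^ j) ∈ S := by
  induction j generalizing N with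
  | zero =>
    rw [pow_zero, PowerSeries.coeff_one]
    split_ifs
    exacts [S.one_mem, S.zero_mem]
  | succ j ih =>
    rw [pow_succ, PowerSeries.coeff_mul]
    exact sum_mem fun p _ => S.mul_mem (ih _) (hf _)

lemma expCoeff_mem {A : Type*} [Ring A] [Algebra ℂ A] (S : Subalgebra ℂ A) {t : ℕ → A}
    (ht : ∀ n, t n ∈ S) (N : ℕ) : expCoeff t N ∈ S := by
  refine sum_mem fun j _ => S.smul_mem (coeff_pow_mem S (fun n => ?_) j N) _
  rw [PowerSeries.coeff_mk]
  split_ifs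
  exacts [S.zero_mem, ht n]

/-- The constant series `u` intertwines the two exponents, hence all their powers; comparing
coefficients needs no commutation among the `t n`. -/
lemma expCoeff_semiconjBy {A : Type*} [Ring A] [Algebra ℂ A] {u : A} {t t' : ℕ → A}
    (h : ∀ n, SemiconjBy u (t n) (t' n)) (N : ℕ) :
    SemiconjBy u (expCoeff t N) (expCoeff t' N) := by
  have key : SemiconjBy (PowerSeries.C u) (PowerSeries.mk fun n => if n = 0 then 0 else t n)
      (PowerSeries.mk fun n => if n = 0 then 0 else t' n) := by
    ext n
    rw [PowerSeries.coeff_C_mul, PowerSeries.coeff_mul_C, PowerSeries.coeff_mk,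
      PowerSeries.coeff_mk]
    split_ifs
    exacts [by simp, h n]
  have hj : ∀ j, SemiconjBy u
      (PowerSeries.coeff N ((PowerSeries.mk fun n => if n = 0 then 0 else t n) ^ j))
      (PowerSeries.coeff N ((PowerSeries.mk fun n => if n = 0 then 0 else t' n) ^ j)) := by
    intro j
    have := congrArg (PowerSeries.coeff N) (key.pow_right j).eq
    rwa [PowerSeries.coeff_C_mul, PowerSeries.coeff_mul_C] at this
  simp only [expCoeff, SemiconjBy, Finset.mul_sum, Finset.sum_mul, mul_smul_comm, smul_mul_assoc]
  exact Finset.sum_congr rfl fun j _ => congrArg _ (hj j).eq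

lemma expCoeff_zero {A : Type*} [Ring A] [Algebra ℂ A] (t : ℕ → A) : expCoeff t 0 = 1 := by
  simp [expCoeff]

/-- In each power `j + 1` of the exponent the factor acting first on `v` is some `t n` with `n ≠ 0`
or zero; the power `0` contributes only in degree `0`. -/
lemma expCoeff_apply_eq_zero {t : ℕ → Module.End ℂ Fock} {v : Fock}
    (h : ∀ n, n ≠ 0 → t n v = 0) {N : ℕ} (hN : N ≠ 0) : expCoeff t N v = 0 := by
  rw [expCoeff, LinearMap.sum_apply]
  refine Finset.sum_eq_zero fun j _ => ?_
  rw [LinearMap.smul_apply]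
  cases j with
  | zero => simp [PowerSeries.coeff_one, hN]
  | succ j =>
    rw [pow_succ, PowerSeries.coeff_mul, LinearMap.sum_apply, Finset.sum_eq_zero, smul_zero]
    intro p _
    rw [PowerSeries.coeff_mk, Module.End.mul_apply]
    split_ifs with hp
    · simp
    · rw [h _ hp, map_zero]

/-! ### Currents shift the sector -/

/-- The operators preserving the vectors of momentum and winding in `A`. -/
noncomputable def sectorAlgebra (A : Set (ℤ × ℤ)) : Subalgebra ℂ (Module.End ℂ Fock) where
  carrier := {T | ∀ v ∈ sector A, T v ∈ sector A}
  mul_mem' hS hT v hv := hS _ (hT v hv)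
  add_mem' hS hT v hv := add_mem (hS v hv) (hT v hv)
  algebraMap_mem' r v hv := by
    rw [Module.algebraMap_end_apply]
    exact Submodule.smul_mem _ _ hv

lemma osc_mem_sectorAlgebra (k : ℕ) (c : Chirality) (j : ℤ) (A : Set (ℤ × ℤ)) :
    osc k c j ∈ sectorAlgebra A :=
  fun _ hv => osc_mem_sector k c j hv

lemma creationPart_mem_sector (k : ℕ) (ε : ℤ) (c : Chirality) (N : ℕ) {A : Set (ℤ × ℤ)}
    {v : Fock} (hv : v ∈ sector A) : creationPart k ε c N v ∈ sector A :=
  have : creationPart k ε c N ∈ sectorAlgebra A :=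
    expCoeff_mem (A := Module.End ℂ Fock) (sectorAlgebra A)
      (fun _ => Subalgebra.smul_mem _ (osc_mem_sectorAlgebra k c _ A) _) N
  this v hv

lemma annihilationPart_mem_sector (k : ℕ) (ε : ℤ) (c : Chirality) (N : ℕ) {A : Set (ℤ × ℤ)}
    {v : Fock} (hv : v ∈ sector A) : annihilationPart k ε c N v ∈ sector A :=
  have : annihilationPart k ε c N ∈ sectorAlgebra A :=
    expCoeff_mem (A := Module.End ℂ Fock) (sectorAlgebra A)
      (fun _ => Subalgebra.smul_mem _ (osc_mem_sectorAlgebra k c _ A) _) N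
  this v hv

lemma shiftOp_single (k : ℕ) (ε : ℤ) (c : Chirality) (b : Label) (r : ℂ) :
    shiftOp k ε c (Finsupp.single b r) = Finsupp.single (b.1, shift k ε c b.2) r := by
  simp [shiftOp, Finsupp.linearCombination_single]

lemma shiftOp_mem_sector (k : ℕ) (ε : ℤ) (c : Chirality) {A B : Set (ℤ × ℤ)}
    (hAB : Set.MapsTo (shift k ε c) A B) {v : Fock} (hv : v ∈ sector A) :
    shiftOp k ε c v ∈ sector B :=
  map_mem_of_mem_sector (fun b hb => by
    rw [shiftOp_single]; exact single_mem_sector (by exact hAB hb) _) hv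

lemma current_single (k : ℕ) (c : Chirality) (ε j : ℤ) (b : Label) :
    current k c ε j (Finsupp.single b 1) = ∑ᶠ e : ℕ × ℕ,
      if ε * charge k c b.2 + (e.1 : ℤ) - (e.2 : ℤ) = -j - (k : ℤ) then
        creationPart k ε c e.1 (shiftOp k ε c (annihilationPart k ε c e.2 (Finsupp.single b 1)))
      else 0 := by
  rw [current, Finsupp.linearCombination_single, one_smul]

lemma current_mem_sector (k : ℕ) (c : Chirality) (ε j : ℤ) {A B : Set (ℤ × ℤ)}
    (hAB : Set.MapsTo (shift k ε c) A B) {v : Fock} (hv : v ∈ sector A) :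
    current k c ε j v ∈ sector B := by
  refine map_mem_of_mem_sector (fun b hb => ?_) hv
  rw [current_single]
  refine finsum_induction (· ∈ sector B) (zero_mem _) (fun _ _ => add_mem) fun e => ?_
  split_ifs
  · exact creationPart_mem_sector _ _ _ _ (shiftOp_mem_sector _ _ _ hAB
      (annihilationPart_mem_sector _ _ _ _ (single_mem_sector hb _)))
  · exact zero_mem _

/-! ### The reflection `a ↦ -a` -/

/-- The label with reversed momentum and winding. -/
def reflect (b : Label) : Label := (b.1, -b.2)

@[simp] lemma reflect_reflect (b : Label) : reflect (reflect b) = b := by simp [reflect]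

/-- The reflection `a_j ↦ -a_j`, `ā_j ↦ -ā_j`, `|m,n⟩ ↦ |-m,-n⟩`. -/
noncomputable def parity : Module.End ℂ Fock :=
  Finsupp.linearCombination ℂ fun b : Label => Finsupp.single (reflect b) ((-1) ^ b.1.degree)

lemma parity_single (b : Label) (r : ℂ) :
    parity (Finsupp.single b r) = ((-1 : ℂ) ^ b.1.degree) • Finsupp.single (reflect b) r := by
  simp [parity, Finsupp.linearCombination_single, mul_comm]

lemma parity_parity (v : Fock) : parity (parity v) = v := by
  have : parity * parity = 1 := by
    ext b : 2
    simp only [LinearMap.comp_apply, Finsupp.lsingle_apply, Module.End.mul_apply, parity_single,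
      map_smul, smul_smul, reflect_reflect, Module.End.one_apply]
    rw [show (reflect b).1 = b.1 from rfl, ← mul_pow]
    simp
  exact LinearMap.congr_fun this v

lemma parity_injective : Function.Injective parity :=
  Function.LeftInverse.injective parity_parity

lemma charge_neg (k : ℕ) (c : Chirality) (w : ℤ × ℤ) : charge k c (-w) = -charge k c w := by
  cases c <;> simp [charge] <;> ring

lemma shift_neg (k : ℕ) (ε : ℤ) (c : Chirality) (w : ℤ × ℤ) :
    shift k (-ε) c (-w) = -shift k ε c w := by
  cases c <;> ext <;> simp [shift] <;> ring

/-- Nonzero modes change the number of quanta by one, and the zero mode is odd in the charge. -/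
lemma parity_osc (k : ℕ) (c : Chirality) (j : ℤ) (v : Fock) :
    parity (osc k c j v) = -osc k c j (parity v) := by
  suffices h : parity ∘ₗ osc k c j = -(osc k c j ∘ₗ parity) from LinearMap.congr_fun h v
  refine Finsupp.lhom_ext fun b r => ?_
  simp only [LinearMap.comp_apply, LinearMap.neg_apply]
  induction j using int_mode_cases with
  | neg n =>
    simp only [osc_neg_single, parity_single, map_smul, map_add, Finsupp.degree_single, pow_succ]
    simp [reflect]
  | zero =>
    simp only [osc_zero_single, parity_single, map_smul, smul_smul, reflect, charge_neg,
      ← neg_smul]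
    congr 1
    push_cast
    ring
  | pos n =>
    simp only [osc_pos_single, parity_single, map_smul]
    -- Without a quantum to remove, truncated subtraction would not lower the degree, but the
    -- coefficient is zero.
    by_cases h : b.1 (c, n) = 0
    · simp [reflect, h]
    · obtain ⟨g, hg⟩ : ∃ g, b.1 = g + Finsupp.single (c, n) 1 := by
        refine ⟨b.1 - Finsupp.single (c, n) 1, (tsub_add_cancel_of_le ?_).symm⟩
        rw [Finsupp.single_le_iff]
        omega
      simp only [reflect, hg, add_tsub_cancel_right, map_add, Finsupp.degree_single, pow_succ,
        smul_smul, ← neg_smul]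
      congr 1
      ring

lemma parity_creationPart (k : ℕ) (ε : ℤ) (c : Chirality) (N : ℕ) :
    SemiconjBy parity (creationPart k ε c N) (creationPart k (-ε) c N) := by
  refine expCoeff_semiconjBy (fun n => LinearMap.ext fun v => ?_) N
  simp only [Module.End.mul_apply, LinearMap.smul_apply, map_smul, parity_osc, smul_neg,
    ← neg_smul]
  congr 1
  push_cast
  ring

lemma parity_annihilationPart (k : ℕ) (ε : ℤ) (c : Chirality) (N : ℕ) :
    SemiconjBy parity (annihilationPart k ε c N) (annihilationPart k (-ε) c N) := by
  refine expCoeff_semiconjBy (fun n => LinearMap.ext fun v => ?_) N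
  simp only [Module.End.mul_apply, LinearMap.smul_apply, map_smul, parity_osc, smul_neg,
    ← neg_smul]
  congr 1
  push_cast
  ring

lemma parity_shiftOp (k : ℕ) (ε : ℤ) (c : Chirality) :
    SemiconjBy parity (shiftOp k ε c) (shiftOp k (-ε) c) := by
  refine Finsupp.lhom_ext fun b r => ?_
  simp only [Module.End.mul_apply, shiftOp_single, parity_single, map_smul]
  simp [reflect, shift_neg]

/-- Both `ε` and the charge change sign, so their product and the pairs `(N, M)` selected by the
mode number `j` stay the same; the three factors are intertwined one by one. -/
lemma parity_current (k : ℕ) (c : Chirality) (ε j : ℤ) :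
    SemiconjBy parity (current k c ε j) (current k c (-ε) j) := by
  ext b : 2
  simp only [LinearMap.comp_apply, Finsupp.lsingle_apply, Module.End.mul_apply]
  rw [current_single, parity_single, map_smul, current_single, smul_finsum]
  -- Injectivity allows the exchange with `∑ᶠ` without proving finite support.
  refine ((parity.toAddMonoidHom).map_finsum_of_injective parity_injective _).trans ?_
  rw [LinearMap.toAddMonoidHom_coe]
  refine finsum_congr fun e => ?_
  have hc : charge k c (reflect b).2 = -charge k c b.2 := charge_neg k c b.2
  rw [hc, neg_mul_neg]
  split_ifs
  · rw [← Module.End.mul_apply, (parity_creationPart k ε c e.1).eq, Module.End.mul_apply,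
      ← Module.End.mul_apply parity, (parity_shiftOp k ε c).eq, Module.End.mul_apply,
      ← Module.End.mul_apply parity, (parity_annihilationPart k ε c e.2).eq, Module.End.mul_apply,
      parity_single, map_smul, map_smul, map_smul]
  · simp

/-! ### Reflection-invariant vectors -/

/-- The invariant vector obtained by symmetrizing a basis vector. -/
noncomputable def symmetrized (b : Label) : Fock :=
  Finsupp.single b 1 + parity (Finsupp.single b 1)

/-- The vectors invariant under the reflection. -/
noncomputable def invariants : Submodule ℂ Fock := LinearMap.eqLocus parity LinearMap.id

lemma mem_invariants {v : Fock} : v ∈ invariants ↔ parity v = v := Iff.rfl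

lemma symmetrized_mem_invariants (b : Label) : symmetrized b ∈ invariants := by
  rw [mem_invariants, symmetrized, map_add, parity_parity, add_comm]

lemma symmetrized_eq (b : Label) : symmetrized b =
    Finsupp.single b 1 + ((-1 : ℂ) ^ b.1.degree) • Finsupp.single (reflect b) 1 := by
  rw [symmetrized, parity_single]

lemma symmetrized_reflect (b : Label) :
    symmetrized (reflect b) = ((-1 : ℂ) ^ b.1.degree) • symmetrized b := by
  rw [symmetrized_eq, symmetrized_eq, reflect_reflect, show (reflect b).1 = b.1 from rfl, smul_add,
    smul_smul, ← mul_pow, add_comm]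
  simp

/-- The projector `(1 + parity) / 2` fixes invariant vectors and sends a basis vector to half its
symmetrization; mirror labels give the same symmetrization up to sign. -/
lemma supported_inf_invariants (B : Set Label) :
    Finsupp.supported ℂ ℂ (B ∪ reflect ⁻¹' B) ⊓ invariants =
      Submodule.span ℂ (symmetrized '' B) := by
  apply le_antisymm
  · rintro v ⟨hv, hv'⟩
    have h : ((1 / 2 : ℂ) • (1 + parity) : Module.End ℂ Fock) v = v := by
      rw [LinearMap.smul_apply, LinearMap.add_apply, Module.End.one_apply, mem_invariants.mp hv',
        ← two_smul ℂ v, smul_smul]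
      norm_num
    rw [← h]
    refine map_mem_of_supported (fun b hb => ?_) hv
    rw [LinearMap.smul_apply, LinearMap.add_apply, Module.End.one_apply]
    refine Submodule.smul_mem _ _ ?_
    change symmetrized b ∈ _
    rcases hb with hb | hb
    · exact Submodule.subset_span ⟨b, hb, rfl⟩
    · rw [← reflect_reflect b, symmetrized_reflect]
      exact Submodule.smul_mem _ _ (Submodule.subset_span ⟨_, hb, rfl⟩)
  · rw [Submodule.span_le]
    rintro _ ⟨b, hb, rfl⟩
    refine ⟨?_, symmetrized_mem_invariants b⟩
    rw [symmetrized_eq]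
    exact add_mem (Finsupp.single_mem_supported ℂ _ (Or.inl hb)) (Submodule.smul_mem _ _
      (Finsupp.single_mem_supported ℂ _ (Or.inr (by simpa using hb))))

/-! ### Products of creation modes -/

/-- The occupation numbers of the product of creation modes given by `x` and `y`. -/
noncomputable def occupation (x y : List ℕ+) : Chirality × ℕ+ →₀ ℕ :=
  (x.map fun n => Finsupp.single (Chirality.left, n) 1).sum +
    (y.map fun n => Finsupp.single (Chirality.right, n) 1).sum

lemma prod_osc_single (k : ℕ) (c : Chirality) (x : List ℕ+) (b : Label) (r : ℂ) :
    (x.map fun n => osc k c (-((n : ℕ) : ℤ))).prod (Finsupp.single b r) =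
      Finsupp.single (b.1 + (x.map fun n => Finsupp.single (c, n) 1).sum, b.2) r := by
  induction x with
  | nil => simp
  | cons n x ih =>
    change (osc k c (-((n : ℕ) : ℤ)) * (x.map fun n => osc k c (-((n : ℕ) : ℤ))).prod)
      (Finsupp.single b r) = _
    rw [Module.End.mul_apply, ih, osc_neg_single, List.map_cons, List.sum_cons]
    simp only [add_assoc, add_comm (Finsupp.single (c, n) 1)]

lemma creators_single (k : ℕ) (x y : List ℕ+) (b : Label) (r : ℂ) :
    creators k x y (Finsupp.single b r) = Finsupp.single (b.1 + occupation x y, b.2) r := by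
  rw [creators, Module.End.mul_apply, prod_osc_single, prod_osc_single, occupation, add_assoc,
    add_comm (List.sum _)]

lemma degree_sum_single (c : Chirality) (x : List ℕ+) :
    (x.map fun n => Finsupp.single (c, n) 1).sum.degree = x.length := by
  induction x with
  | nil => simp
  | cons n x ih => rw [List.map_cons, List.sum_cons, map_add, ih]; simp [add_comm]

lemma degree_occupation (x y : List ℕ+) : (occupation x y).degree = x.length + y.length := by
  rw [occupation, map_add, degree_sum_single, degree_sum_single]

lemma occupation_surjective (f : Chirality × ℕ+ →₀ ℕ) : ∃ x y, occupation x y = f := by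
  induction f using Finsupp.induction_linear with
  | zero => exact ⟨[], [], by simp [occupation]⟩
  | add f g hf hg =>
    obtain ⟨x, y, rfl⟩ := hf
    obtain ⟨x', y', rfl⟩ := hg
    refine ⟨x ++ x', y ++ y', ?_⟩
    simp only [occupation, List.map_append, List.sum_append]
    abel
  | single i a =>
    obtain ⟨c, n⟩ := i
    cases c
    · exact ⟨List.replicate a n, [], by simp [occupation]⟩
    · exact ⟨[], List.replicate a n, by simp [occupation]⟩

lemma creators_ket_of_even (k : ℕ) {x y : List ℕ+} (h : Even (x.length + y.length)) (m n : ℤ) :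
    creators k x y (ket m n + ket (-m) (-n)) = symmetrized (occupation x y, (m, n)) := by
  rw [← degree_occupation] at h
  rw [symmetrized_eq, map_add, ket, ket, creators_single, creators_single, h.neg_one_pow, one_smul]
  simp [reflect]

lemma creators_ket_of_odd (k : ℕ) {x y : List ℕ+} (h : Odd (x.length + y.length)) (m n : ℤ) :
    creators k x y (ket m n - ket (-m) (-n)) = symmetrized (occupation x y, (m, n)) := by
  rw [← degree_occupation] at h
  rw [symmetrized_eq, map_sub, ket, ket, creators_single, creators_single, h.neg_one_pow,
    neg_smul, one_smul, sub_eq_add_neg]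
  simp [reflect]

/-- The sign between the two kets is `(-1)` to the number of creators, which is exactly the sign in
`parity`; the even and odd families merge into one. -/
lemma untwisted_eq_span (k : ℕ) (m n : ℤ) :
    untwisted k m n = Submodule.span ℂ (symmetrized '' {b | b.2 = (m, n)}) := by
  rw [untwisted, ← Submodule.span_union]
  congr 1
  ext v
  constructor
  · rintro (⟨x, y, h, rfl⟩ | ⟨x, y, h, rfl⟩)
    · exact ⟨_, rfl, (creators_ket_of_even k h m n).symm⟩
    · exact ⟨_, rfl, (creators_ket_of_odd k h m n).symm⟩
  · rintro ⟨⟨f, w⟩, rfl, rfl⟩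
    obtain ⟨x, y, rfl⟩ := occupation_surjective f
    rcases Nat.even_or_odd (x.length + y.length) with h | h
    · exact Or.inl ⟨x, y, h, (creators_ket_of_even k h m n).symm⟩
    · exact Or.inr ⟨x, y, h, (creators_ket_of_odd k h m n).symm⟩

/-! ### The charges of the representation -/

/-- Momentum and winding of the summand with index `(s, s')`. -/
def position (k l : ℕ) (s : ℤ × ℤ) : ℤ × ℤ := (s.1 + s.2, k * (s.1 - s.2) + l)

/-- The labels with momentum and winding in the charge lattice of the representation. -/
def latticeLabels (k l : ℕ) : Set Label := {b | b.2 ∈ Set.range (position k l)}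

lemma summand_eq_span (k l : ℕ) (s : ℤ × ℤ) :
    summand k l s = Submodule.span ℂ (symmetrized '' {b | b.2 = position k l s}) :=
  untwisted_eq_span k _ _

lemma iSup_summand (k l : ℕ) :
    ⨆ s, summand k l s = Submodule.span ℂ (symmetrized '' latticeLabels k l) := by
  simp only [summand_eq_span]
  rw [← Submodule.span_iUnion, ← Set.image_iUnion]
  congr 2
  ext b
  simp [latticeLabels, eq_comm]

lemma position_injective {k : ℕ} (hk : 0 < k) (l : ℕ) : Function.Injective (position k l) := by
  rintro ⟨s, s'⟩ ⟨t, t'⟩ h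
  simp only [position, Prod.mk.injEq, add_left_inj] at h
  have hk' : (k : ℤ) ≠ 0 := by exact_mod_cast hk.ne'
  have := mul_left_cancel₀ hk' h.2
  ext <;> simp only <;> omega

lemma two_mul_mul_add_ne_zero {k l : ℕ} (hl : 0 < l) (hlk : l < k) (s : ℤ) :
    2 * (k : ℤ) * s + l ≠ 0 := by
  have h1 : (0 : ℤ) < l := by exact_mod_cast hl
  have h2 : (l : ℤ) < k := by exact_mod_cast hlk
  rcases lt_or_ge s 0 with h | h
  · nlinarith
  · nlinarith

lemma charge_left_position (k l : ℕ) (s : ℤ × ℤ) :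
    charge k .left (position k l s) = 2 * k * s.1 + l := by
  simp only [charge, position]; ring

lemma charge_right_position (k l : ℕ) (s : ℤ × ℤ) :
    charge k .right (position k l s) = 2 * k * s.2 - l := by
  simp only [charge, position]; ring

lemma charge_position_ne_zero {k l : ℕ} (hl : 0 < l) (hlk : l < k) (c : Chirality) (s : ℤ × ℤ) :
    charge k c (position k l s) ≠ 0 := by
  cases c
  · rw [charge_left_position]
    exact two_mul_mul_add_ne_zero hl hlk _
  · rw [charge_right_position]
    have := two_mul_mul_add_ne_zero hl hlk (-s.2)
    contrapose! this
    linarith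

/-- Equality of the left charges would make `l` a multiple of `k`. -/
lemma position_ne_neg_position {k l : ℕ} (hl : 0 < l) (hlk : l < k) (s t : ℤ × ℤ) :
    position k l s ≠ -position k l t := by
  intro h
  have h' := congrArg (charge k .left) h
  rw [charge_neg, charge_left_position, charge_left_position] at h'
  have h1 : (0 : ℤ) < l := by exact_mod_cast hl
  have h2 : (l : ℤ) < k := by exact_mod_cast hlk
  have h3 : (l : ℤ) = k * (-(s.1 + t.1)) := by linarith
  have := Int.le_of_dvd h1 ⟨_, h3⟩
  omega

lemma charge_shift (k : ℕ) (ε : ℤ) (c : Chirality) (w : ℤ × ℤ) :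
    charge k c (shift k ε c w) = charge k c w + 2 * k * ε := by
  cases c <;> simp only [charge, shift] <;> ring

/-- The index of the summand reached by a charge shift. -/
def indexShift (ε : ℤ) : Chirality → ℤ × ℤ → ℤ × ℤ
  | .left, s => (s.1 + ε, s.2)
  | .right, s => (s.1, s.2 + ε)

lemma shift_position (k l : ℕ) (ε : ℤ) (c : Chirality) (s : ℤ × ℤ) :
    shift k ε c (position k l s) = position k l (indexShift ε c s) := by
  cases c <;> ext <;> simp only [shift, position, indexShift] <;> ring

lemma mapsTo_shift (k l : ℕ) (ε : ℤ) (c : Chirality) :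
    Set.MapsTo (shift k ε c) (Set.range (position k l) ∪ -Set.range (position k l))
      (Set.range (position k l) ∪ -Set.range (position k l)) := by
  rintro w (⟨s, rfl⟩ | ⟨s, hs⟩)
  · exact Or.inl ⟨_, (shift_position k l ε c s).symm⟩
  · refine Or.inr ⟨indexShift (-ε) c s, ?_⟩
    rw [← shift_position, hs, shift_neg]

/-! ### Linear independence of the summands -/

lemma disjoint_supported {B B' : Set Label} (h : Disjoint B B') :
    Disjoint (Finsupp.supported ℂ ℂ B) (Finsupp.supported ℂ ℂ B') :=
  Finsupp.disjoint_supported_supported h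

/-- Each summand is supported on one lattice charge and its negative, and these pairs are disjoint
for different indices. -/
lemma iSupIndep_summand {k l : ℕ} (hl : 0 < l) (hlk : l < k) : iSupIndep (summand k l) := by
  have hle : ∀ s, summand k l s ≤
      sector {w | w = position k l s ∨ -w = position k l s} := by
    intro s
    rw [summand_eq_span, ← supported_inf_invariants]
    exact inf_le_left
  intro s
  refine Disjoint.mono (hle s) (iSup₂_le fun t ht => (hle t).trans ?_)
    (disjoint_supported (B' := {b | ∃ t ≠ s, b.2 = position k l t ∨ -b.2 = position k l t}) ?_)
  · exact Finsupp.supported_mono fun b hb => ⟨t, ht, hb⟩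
  · rw [Set.disjoint_left]
    rintro b hs ⟨t, hts, ht⟩
    rcases hs with hs | hs <;> rcases ht with ht | ht
    · exact hts (position_injective (hl.trans hlk) l (ht.symm.trans hs))
    · exact position_ne_neg_position hl hlk t s (by rw [← ht, ← hs])
    · exact position_ne_neg_position hl hlk s t (by rw [← ht, ← hs])
    · exact hts (position_injective (hl.trans hlk) l (ht.symm.trans hs))

/-! ### Invariance of the representation under the symmetry algebra -/

/-- The space of the representation. -/
noncomputable def representation (k l : ℕ) : Submodule ℂ Fock :=
  Submodule.span ℂ (symmetrized '' latticeLabels k l)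

lemma mem_representation (k l : ℕ) {v : Fock} : v ∈ representation k l ↔
    v ∈ sector (Set.range (position k l) ∪ -Set.range (position k l)) ∧ parity v = v := by
  rw [representation, ← supported_inf_invariants]
  rfl

lemma symmetrySet_mem_representation (k l : ℕ) {T : Module.End ℂ Fock} (hT : T ∈ symmetrySet k)
    {v : Fock} (hv : v ∈ representation k l) : T v ∈ representation k l := by
  rw [mem_representation] at hv ⊢
  obtain ⟨hs, hp⟩ := hv
  have hJs : ∀ c ε j, current k c ε j v ∈
      sector (Set.range (position k l) ∪ -Set.range (position k l)) := fun c ε j =>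
    current_mem_sector k c ε j (mapsTo_shift k l ε c) hs
  have hJp : ∀ c ε j, parity (current k c ε j v) = current k c (-ε) j v := fun c ε j => by
    rw [← Module.End.mul_apply, (parity_current k c ε j).eq, Module.End.mul_apply, hp]
  obtain ⟨c, ⟨i, j, rfl⟩ | ⟨j, rfl⟩ | ⟨i, j, rfl⟩⟩ := hT
  · simp only [Module.End.mul_apply, parity_osc, hp, map_neg, neg_neg, and_true]
    exact osc_mem_sector _ _ _ (osc_mem_sector _ _ _ hs)
  · simp only [LinearMap.add_apply, map_add, hJp, neg_neg]
    exact ⟨add_mem (hJs _ _ _) (hJs _ _ _), add_comm _ _⟩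
  · simp only [Module.End.mul_apply, LinearMap.sub_apply, parity_osc, map_sub, hJp, neg_neg]
    exact ⟨sub_mem (osc_mem_sector _ _ _ (hJs _ _ _)) (osc_mem_sector _ _ _ (hJs _ _ _)), by abel⟩

lemma ket_add_ket (m n : ℤ) : ket m n + ket (-m) (-n) = symmetrized (0, (m, n)) := by
  rw [symmetrized_eq]
  simp [ket, reflect]

lemma generated_le_representation (k l : ℕ) :
    generated k (ket 0 (l : ℤ) + ket 0 (-(l : ℤ))) ≤ representation k l := by
  rintro _ ⟨T, hT, rfl⟩
  have h0 : ket 0 (l : ℤ) + ket 0 (-(l : ℤ)) ∈ representation k l := by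
    have := ket_add_ket 0 l
    rw [neg_zero] at this
    rw [this]
    exact Submodule.subset_span ⟨_, ⟨0, by simp [position]⟩, rfl⟩
  have hT' : T ∈ Algebra.adjoin ℂ (symmetrySet k) := hT
  suffices ∀ v ∈ representation k l, T v ∈ representation k l from this _ h0
  clear hT
  induction hT' using Algebra.adjoin_induction with
  | mem T hT => exact fun v hv => symmetrySet_mem_representation k l hT hv
  | algebraMap r =>
    intro v hv
    rw [Module.algebraMap_end_apply]
    exact Submodule.smul_mem _ _ hv
  | add S T _ _ hS hT => exact fun v hv => add_mem (hS v hv) (hT v hv)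
  | mul S T _ _ hS hT => exact fun v hv => hS _ (hT v hv)

/-! ### Cyclicity of the representation -/

lemma mem_generated_self (k : ℕ) (v : Fock) : v ∈ generated k v :=
  ⟨1, one_mem (Algebra.adjoin ℂ (symmetrySet k)), rfl⟩

lemma symmetrySet_mem_generated {k : ℕ} {v u : Fock} {T : Module.End ℂ Fock}
    (hT : T ∈ symmetrySet k) (hu : u ∈ generated k v) : T u ∈ generated k v := by
  obtain ⟨S, hS, rfl⟩ := hu
  exact ⟨T * S, (Algebra.adjoin ℂ (symmetrySet k)).mul_mem (Algebra.subset_adjoin hT) hS, rfl⟩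

lemma osc_osc_mem_generated {k : ℕ} {v u : Fock} (c : Chirality) (i j : ℤ)
    (hu : u ∈ generated k v) : osc k c i (osc k c j u) ∈ generated k v :=
  symmetrySet_mem_generated (T := osc k c i * osc k c j) ⟨c, Or.inl ⟨i, j, rfl⟩⟩ hu

/-- In `a_{-n} a_0` the zero mode acts by opposite nonzero scalars on the vector and its mirror
image, and this sign compensates the one from `a_{-n}`. -/
lemma symmetrized_add_single_mem_generated {k : ℕ} (hk : 0 < k) {v : Fock} {b : Label}
    {c : Chirality} (hc : charge k c b.2 ≠ 0) (n : ℕ+) (hb : symmetrized b ∈ generated k v) :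
    symmetrized (b.1 + Finsupp.single (c, n) 1, b.2) ∈ generated k v := by
  have h := osc_osc_mem_generated c (-((n : ℕ) : ℤ)) 0 hb
  have h0 : (charge k c b.2 : ℂ) / rootTwo k ≠ 0 :=
    div_ne_zero (by exact_mod_cast hc) (rootTwo_ne_zero hk)
  have key : osc k c (-((n : ℕ) : ℤ)) (osc k c 0 (symmetrized b)) =
      ((charge k c b.2 : ℂ) / rootTwo k) •
        symmetrized (b.1 + Finsupp.single (c, n) 1, b.2) := by
    have hp : ∀ j u, osc k c j (parity u) = -parity (osc k c j u) := fun j u => by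
      rw [parity_osc, neg_neg]
    rw [symmetrized, map_add, hp, osc_zero_single, map_smul, map_add, map_neg, map_smul, map_smul,
      hp, osc_neg_single, smul_neg, neg_neg, ← smul_add, symmetrized]
  rw [key] at h
  exact (Submodule.smul_mem_iff _ h0).mp h

lemma symmetrized_mem_generated {k : ℕ} (hk : 0 < k) {v : Fock} {w : ℤ × ℤ}
    (hc : ∀ c, charge k c w ≠ 0) (hw : symmetrized (0, w) ∈ generated k v)
    (f : Chirality × ℕ+ →₀ ℕ) : symmetrized (f, w) ∈ generated k v := by
  -- Starting from an arbitrary `g` makes the claim additive in `f`.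
  suffices ∀ g, symmetrized (g, w) ∈ generated k v → symmetrized (g + f, w) ∈ generated k v by
    simpa using this 0 hw
  induction f using Finsupp.induction_linear with
  | zero => intro g hg; simpa using hg
  | add f f' hf hf' => intro g hg; rw [← add_assoc]; exact hf' _ (hf _ hg)
  | single i a =>
    intro g hg
    induction a with
    | zero => simpa using hg
    | succ a ih =>
      rw [Finsupp.single_add, ← add_assoc]
      exact symmetrized_add_single_mem_generated hk (b := (_, w)) (hc i.1) i.2 ih

lemma osc_zero_of_mem_sector {k : ℕ} {c : Chirality} {w : ℤ × ℤ} {v : Fock}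
    (hv : v ∈ sector {w}) : osc k c 0 v = ((charge k c w : ℂ) / rootTwo k) • v := by
  have : (osc k c 0 - ((charge k c w : ℂ) / rootTwo k) • (1 : Module.End ℂ Fock)) v ∈
      (⊥ : Submodule ℂ Fock) := by
    refine map_mem_of_mem_sector (fun b hb => ?_) hv
    rw [Set.mem_singleton_iff] at hb
    rw [LinearMap.sub_apply, osc_zero_single, hb]
    simp
  rw [Submodule.mem_bot, LinearMap.sub_apply, sub_eq_zero] at this
  simpa using this

lemma osc_pos_ket (k : ℕ) (c : Chirality) {n : ℕ} (hn : n ≠ 0) (w : ℤ × ℤ) (r : ℂ) :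
    osc k c (n : ℤ) (Finsupp.single (0, w) r) = 0 := by
  have := osc_pos_single k c ⟨n, Nat.pos_of_ne_zero hn⟩ (0, w) r
  simpa using this

/-- This mode number forces `N = M`, and every `M > 0` annihilates the ground state. -/
lemma current_ket (k : ℕ) (c : Chirality) (ε : ℤ) (w : ℤ × ℤ) :
    current k c ε (-(ε * charge k c w) - k) (Finsupp.single (0, w) 1) =
      Finsupp.single (0, shift k ε c w) 1 := by
  have hA : ∀ N, N ≠ 0 → annihilationPart k ε c N (Finsupp.single (0, w) 1) = 0 := fun N hN =>
    expCoeff_apply_eq_zero (fun n hn => by rw [LinearMap.smul_apply, osc_pos_ket k c hn, smul_zero])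
      hN
  rw [current_single, finsum_eq_single _ (0, 0)]
  · have h1 : creationPart k ε c 0 = 1 := expCoeff_zero _
    have h2 : annihilationPart k ε c 0 = 1 := expCoeff_zero _
    simp [h1, h2, shiftOp_single]
  · rintro ⟨e₁, e₂⟩ he
    split_ifs with h
    · have : e₂ ≠ 0 := by
        rintro rfl
        apply he
        have : e₁ = 0 := by push_cast at h; linarith
        rw [this]
      simp [hA e₂ this]
    · rfl

lemma symmetrized_shift_mem_generated {k : ℕ} (hk : 0 < k) {v : Fock} {w : ℤ × ℤ} {c : Chirality}
    (hc : charge k c w ≠ 0) {ε : ℤ} (hε : ε = 1 ∨ ε = -1)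
    (hw : symmetrized (0, w) ∈ generated k v) :
    symmetrized (0, shift k ε c w) ∈ generated k v := by
  set j := -(ε * charge k c w) - (k : ℤ) with hj
  -- `j` is tuned so that `J^ε_j` yields the shifted ground state; `X` is the by-product in the
  -- oppositely shifted sector, whose precise form is irrelevant.
  set X := current k c (-ε) j (Finsupp.single (0, w) 1) with hX
  have hXs : X ∈ sector {shift k (-ε) c w} :=
    current_mem_sector k c (-ε) j (A := {w}) (by rintro _ rfl; rfl)
      (single_mem_sector (b := (0, w)) (Set.mem_singleton w) _)
  have hp : ∀ ε u, current k c ε j (parity u) = parity (current k c (-ε) j u) := fun ε u => by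
    have := LinearMap.congr_fun (parity_current k c (-ε) j).eq u
    rw [neg_neg] at this
    exact this.symm
  have hT : current k c ε j + current k c (-ε) j ∈ symmetrySet k := by
    refine ⟨c, Or.inr (Or.inl ⟨j, ?_⟩)⟩
    rcases hε with rfl | rfl
    · rfl
    · rw [neg_neg, add_comm]
  have hTw : (current k c ε j + current k c (-ε) j) (symmetrized (0, w)) =
      symmetrized (0, shift k ε c w) + (X + parity X) := by
    rw [symmetrized, LinearMap.add_apply, map_add, map_add, hp, hp, neg_neg, ← hX, hj, current_ket,
      symmetrized]
    abel
  have hmem := symmetrySet_mem_generated hT hw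
  rw [hTw] at hmem
  have hAA : ∀ (w' : ℤ × ℤ) (u : Fock), u ∈ sector {w'} → osc k c 0 (osc k c 0 (u + parity u)) =
      (((charge k c w' : ℂ) / rootTwo k) ^ 2) • (u + parity u) := by
    intro w' u hu
    have h2 : osc k c 0 (osc k c 0 u) = (((charge k c w' : ℂ) / rootTwo k) ^ 2) • u := by
      rw [osc_zero_of_mem_sector hu, map_smul, osc_zero_of_mem_sector hu, smul_smul, sq]
    have h3 : osc k c 0 (osc k c 0 (parity u)) = parity (osc k c 0 (osc k c 0 u)) := by
      rw [parity_osc, parity_osc, map_neg, neg_neg]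
    rw [map_add, map_add, h3, h2, map_smul, smul_add]
  have hmem' := osc_osc_mem_generated c 0 0 hmem
  rw [map_add, map_add, hAA _ X hXs, symmetrized,
    hAA _ _ (single_mem_sector (b := (0, shift k ε c w)) (Set.mem_singleton _) _)] at hmem'
  rw [symmetrized] at hmem
  -- Subtracting the `a_0 ^ 2` eigenvalue of the `X` sector eliminates `X + parity X`.
  have hdiff := sub_mem hmem' (Submodule.smul_mem _
    (((charge k c (shift k (-ε) c w) : ℂ) / rootTwo k) ^ 2) hmem)
  have hlin : ∀ (α β : ℂ) (Y Z : Fock), α • Y + β • Z - β • (Y + Z) = (α - β) • Y := by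
    intros
    module
  rw [hlin] at hdiff
  refine (Submodule.smul_mem_iff _ ?_).mp hdiff
  rw [charge_shift, charge_shift, div_pow, div_pow, ← sub_div, rootTwo_sq]
  have hk' : (k : ℂ) ≠ 0 := by exact_mod_cast hk.ne'
  refine div_ne_zero ?_ (by simpa using hk.ne')
  -- The eigenvalue gap is proportional to the initial charge, so a nonzero charge is needed here.
  have : ((charge k c w + 2 * k * ε : ℤ) : ℂ) ^ 2 - ((charge k c w + 2 * k * -ε : ℤ) : ℂ) ^ 2 =
      8 * k * ε * charge k c w := by
    push_cast
    ring
  rw [this]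
  have hc' : (charge k c w : ℂ) ≠ 0 := by exact_mod_cast hc
  have hε' : (ε : ℂ) ≠ 0 := by rcases hε with rfl | rfl <;> simp
  simp [hk', hc', hε']

lemma symmetrized_position_mem_generated {k l : ℕ} (hl : 0 < l) (hlk : l < k) (s : ℤ × ℤ) :
    symmetrized (0, position k l s) ∈ generated k (ket 0 (l : ℤ) + ket 0 (-(l : ℤ))) := by
  have step : ∀ (c : Chirality) (ε : ℤ) (s : ℤ × ℤ), ε = 1 ∨ ε = -1 →
      symmetrized (0, position k l s) ∈ generated k (ket 0 (l : ℤ) + ket 0 (-(l : ℤ))) →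
      symmetrized (0, position k l (indexShift ε c s)) ∈
        generated k (ket 0 (l : ℤ) + ket 0 (-(l : ℤ))) := by
    intro c ε s hε hs
    rw [← shift_position]
    exact symmetrized_shift_mem_generated (hl.trans hlk) (charge_position_ne_zero hl hlk c s) hε hs
  obtain ⟨s, s'⟩ := s
  induction s with
  | zero =>
    induction s' with
    | zero =>
      have := ket_add_ket 0 l
      rw [neg_zero] at this
      rw [this]
      simpa [position] using mem_generated_self k (symmetrized (0, (0, (l : ℤ))))
    | succ i ih => simpa only [indexShift] using step .right 1 _ (Or.inl rfl) ih
    | pred i ih => simpa only [indexShift, ← sub_eq_add_neg] using step .right (-1) _ (Or.inr rfl) ih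
  | succ i ih => simpa only [indexShift] using step .left 1 _ (Or.inl rfl) ih
  | pred i ih => simpa only [indexShift, ← sub_eq_add_neg] using step .left (-1) _ (Or.inr rfl) ih

lemma generated_eq_representation {k l : ℕ} (hl : 0 < l) (hlk : l < k) :
    generated k (ket 0 (l : ℤ) + ket 0 (-(l : ℤ))) = representation k l := by
  refine le_antisymm (generated_le_representation k l) (Submodule.span_le.mpr ?_)
  rintro _ ⟨⟨f, _⟩, ⟨s, rfl⟩, rfl⟩
  exact symmetrized_mem_generated (hl.trans hlk)
    (fun c => charge_position_ne_zero hl hlk c s) (symmetrized_position_mem_generated hl hlk s) f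

/-! ### Virasoro weights -/

open Classical in
/-- The level of the given occupation numbers in one chirality. -/
noncomputable def level (c : Chirality) (f : Chirality × ℕ+ →₀ ℕ) : ℕ :=
  f.sum fun i a => if i.1 = c then (i.2 : ℕ) * a else 0

/-- The `L_0` (left) or `L̄_0` (right) eigenvalue of a basis vector. -/
noncomputable def weight (k : ℕ) (c : Chirality) (b : Label) : ℝ :=
  (charge k c b.2 : ℝ) ^ 2 / (4 * k) + level c b.1

/-- The eigenvalue of `a_{-n} a_n` on a basis vector with occupation numbers `f`. -/
noncomputable def modeEnergy (c : Chirality) (f : Chirality × ℕ+ →₀ ℕ) (n : ℕ) : ℕ :=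
  if h : 0 < n then n * f (c, ⟨n, h⟩) else 0

lemma hasSum_modeEnergy (c : Chirality) (f : Chirality × ℕ+ →₀ ℕ) :
    HasSum (fun n => (modeEnergy c f n : ℂ)) (level c f : ℂ) := by
  classical
  induction f using Finsupp.induction_linear with
  | zero => simp [modeEnergy, level, hasSum_zero]
  | add f g hf hg =>
    convert! hf.add hg using 1
    · ext n
      simp only [modeEnergy]
      split_ifs
      · rw [Finsupp.add_apply]; push_cast; ring
      · simp
    · rw [level, Finsupp.sum_add_index' (by simp) (by intros; split_ifs <;> ring), Nat.cast_add,
        level, level]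
  | single i a =>
    have hl : level c (Finsupp.single i a) = if i.1 = c then (i.2 : ℕ) * a else 0 := by
      rw [level, Finsupp.sum_single_index (by simp)]
    have h := hasSum_single (f := fun n => (modeEnergy c (Finsupp.single i a) n : ℂ)) (i.2 : ℕ) ?_
    · convert! h using 1
      rw [hl]
      obtain ⟨d, m⟩ := i
      simp only [modeEnergy, m.pos, dite_true]
      by_cases h : d = c
      · have h' : Finsupp.single (d, m) a (c, ⟨m, m.pos⟩) = a := by
          rw [h]; exact Finsupp.single_eq_same
        rw [if_pos h, h']
      · rw [if_neg h, Finsupp.single_eq_of_ne (fun h' => h (Prod.ext_iff.mp h').1.symm), mul_zero]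
    · intro n hn
      simp only [modeEnergy]
      split_ifs with h
      · rw [Finsupp.single_eq_of_ne]
        · simp
        · rintro rfl
          exact hn rfl
      · simp

lemma finite_support_modeEnergy (c : Chirality) (f : Chirality × ℕ+ →₀ ℕ) :
    (Function.support (modeEnergy c f)).Finite := by
  refine (f.support.finite_toSet.image fun i => (i.2 : ℕ)).subset fun n hn => ?_
  rw [Function.mem_support, modeEnergy] at hn
  split_ifs at hn with h
  · exact ⟨(c, ⟨n, h⟩), by simpa using (mul_ne_zero_iff.mp hn).2, rfl⟩
  · exact absurd rfl hn

lemma osc_osc_single (k : ℕ) (c : Chirality) (n : ℕ+) (b : Label) :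
    osc k c (-((n : ℕ) : ℤ)) (osc k c ((n : ℕ) : ℤ) (Finsupp.single b 1)) =
      (modeEnergy c b.1 n : ℂ) • Finsupp.single b 1 := by
  rw [osc_pos_single, map_smul, osc_neg_single, modeEnergy, dif_pos n.pos]
  by_cases h : b.1 (c, n) = 0
  · rw [h]
    have h' : b.1 (c, ⟨n, n.pos⟩) = 0 := h
    simp [h']
  · rw [tsub_add_cancel_of_le]
    · push_cast
      rfl
    · rw [Finsupp.single_le_iff]
      omega

lemma normalOrdered_single {k : ℕ} (c : Chirality) (n : ℤ) (b : Label) :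
    normalOrdered k c n (Finsupp.single b 1) =
      ((modeEnergy c b.1 n.natAbs : ℂ) + if n = 0 then (charge k c b.2 : ℂ) ^ 2 / (2 * k) else 0) •
        Finsupp.single b 1 := by
  induction n using int_mode_cases with
  | neg n =>
    have h : ¬ (0 : ℤ) ≤ -((n : ℕ) : ℤ) := by have := n.pos; omega
    rw [normalOrdered, if_neg h, neg_neg, Module.End.mul_apply, osc_osc_single]
    simp
  | zero =>
    rw [normalOrdered, if_pos le_rfl, neg_zero, Module.End.mul_apply, osc_zero_single, map_smul,
      osc_zero_single, smul_smul, ← sq, div_pow, rootTwo_sq]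
    simp [modeEnergy]
  | pos n =>
    rw [normalOrdered, if_pos (by positivity), Module.End.mul_apply, osc_osc_single]
    simp

/-- Normal ordering counts each positive mode at both `n` and `-n`, which cancels the `1 / 2` in
`L_0`; the zero mode occurs once. -/
lemma finsum_modeEnergy (c : Chirality) (f : Chirality × ℕ+ →₀ ℕ) (z : ℂ) :
    ∑ᶠ n : ℤ, ((modeEnergy c f n.natAbs : ℂ) + if n = 0 then z else 0) = 2 * level c f + z := by
  have hfin : Function.HasFiniteSupport
      fun n : ℤ => (modeEnergy c f n.natAbs : ℂ) + if n = 0 then z else 0 := by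
    refine ((((finite_support_modeEnergy c f).preimage' (f := Int.natAbs) fun m _ => ?_)).union
      (Set.finite_singleton 0)).subset fun n hn => ?_
    · refine (Set.finite_Icc (-(m : ℤ)) m).subset fun n hn => ?_
      simp only [Set.mem_preimage, Set.mem_singleton_iff] at hn
      simp only [Set.mem_Icc]
      omega
    · by_contra h
      simp only [Set.mem_union, Set.mem_preimage, Function.mem_support, not_or, not_not,
        Set.mem_singleton_iff] at h
      simp [h.1, h.2] at hn
  rw [← tsum_eq_finsum (L := SummationFilter.unconditional ℤ) hfin]
  refine HasSum.tsum_eq (HasSum.add ?_ (hasSum_ite_eq 0 z))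
  have := HasSum.of_nat_of_neg (f := fun n : ℤ => (modeEnergy c f n.natAbs : ℂ))
    (by simpa using hasSum_modeEnergy c f) (by simpa using hasSum_modeEnergy c f)
  convert! this using 1
  simp [modeEnergy]
  ring

lemma virasoroZero_single (k : ℕ) (c : Chirality) (b : Label) (r : ℂ) :
    virasoroZero k c (Finsupp.single b r) = (weight k c b : ℂ) • Finsupp.single b r := by
  rw [virasoroZero, Finsupp.linearCombination_single]
  simp only [normalOrdered_single]
  rw [← finsum_smul, finsum_modeEnergy, smul_smul, smul_smul, weight, Finsupp.smul_single,
    Finsupp.smul_single]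
  congr 1
  simp only [smul_eq_mul, mul_one]
  push_cast
  ring

lemma virasoroZero_apply (k : ℕ) (c : Chirality) (v : Fock) (b : Label) :
    virasoroZero k c v b = (weight k c b : ℂ) * v b := by
  have : Finsupp.lapply b ∘ₗ virasoroZero k c =
      (weight k c b : ℂ) • (Finsupp.lapply b : Fock →ₗ[ℂ] ℂ) := by
    refine Finsupp.lhom_ext fun b' r => ?_
    simp only [LinearMap.comp_apply, virasoroZero_single, Finsupp.lapply_apply,
      LinearMap.smul_apply, Finsupp.smul_apply, smul_eq_mul]
    by_cases h : b' = b
    · rw [h]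
    · rw [Finsupp.single_eq_of_ne (Ne.symm h), mul_zero, mul_zero]
  exact LinearMap.congr_fun this v

lemma weight_reflect (k : ℕ) (c : Chirality) (b : Label) :
    weight k c (reflect b) = weight k c b := by
  simp [weight, reflect, charge_neg]

lemma mem_eigenspace_virasoroZero {k : ℕ} {c : Chirality} {r : ℝ} {v : Fock} :
    v ∈ Module.End.eigenspace (virasoroZero k c) (r : ℂ) ↔
      v ∈ Finsupp.supported ℂ ℂ {b | weight k c b = r} := by
  rw [Module.End.mem_eigenspace_iff, Finsupp.mem_supported']
  constructor
  · intro h b hb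
    have hb' := DFunLike.congr_fun h b
    rw [virasoroZero_apply, Finsupp.smul_apply, smul_eq_mul, ← sub_eq_zero, ← sub_mul,
      mul_eq_zero] at hb'
    refine hb'.resolve_left fun h0 => hb ?_
    rw [sub_eq_zero] at h0
    exact_mod_cast h0
  · intro h
    ext b
    rw [virasoroZero_apply, Finsupp.smul_apply, smul_eq_mul]
    by_cases hb : weight k c b = r
    · rw [hb]
    · rw [h b hb, mul_zero, mul_zero]

/-! ### Weight spaces of the representation -/

/-- The lattice labels with given `L_0` and `L̄_0` eigenvalues. -/
def weightLabels (k l : ℕ) (w : ℝ × ℝ) : Set Label :=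
  {b | b ∈ latticeLabels k l ∧ weight k .left b = w.1 ∧ weight k .right b = w.2}

/-- Weights are quadratic in the charge, so a label and its mirror have equal weights and the
condition is compatible with symmetrization. -/
lemma weightSpace_representation (k l : ℕ) (w : ℝ × ℝ) :
    weightSpace k (representation k l) w =
      Submodule.span ℂ (symmetrized '' weightLabels k l w) := by
  rw [← supported_inf_invariants]
  ext v
  simp only [weightSpace, representation, ← supported_inf_invariants, Submodule.mem_inf,
    mem_eigenspace_virasoroZero, Finsupp.mem_supported, Set.subset_def, weightLabels,
    Set.mem_union, Set.mem_preimage, Set.mem_ofPred_eq, weight_reflect]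
  constructor
  · rintro ⟨⟨h1, h2⟩, h3, h4⟩
    exact ⟨fun b hb => (h1 b hb).imp (fun h => ⟨h, h3 b hb, h4 b hb⟩)
      (fun h => ⟨h, h3 b hb, h4 b hb⟩), h2⟩
  · rintro ⟨h1, h2⟩
    exact ⟨⟨fun b hb => (h1 b hb).imp And.left And.left, h2⟩,
      fun b hb => (h1 b hb).elim (fun h => h.2.1) (fun h => h.2.1),
      fun b hb => (h1 b hb).elim (fun h => h.2.2) (fun h => h.2.2)⟩

lemma iSup_weightSpace_representation (k l : ℕ) :
    ⨆ w, weightSpace k (representation k l) w = representation k l := by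
  refine le_antisymm (iSup_le fun w => inf_le_left) (Submodule.span_le.mpr ?_)
  rintro _ ⟨b, hb, rfl⟩
  refine Submodule.mem_iSup_of_mem (weight k .left b, weight k .right b) ?_
  rw [weightSpace_representation]
  exact Submodule.subset_span ⟨b, ⟨hb, rfl, rfl⟩, rfl⟩

/-- Mirror labels lie off the lattice, so restricting coordinates to lattice labels turns
symmetrized vectors into unit vectors. -/
lemma linearIndepOn_symmetrized {k l : ℕ} (hl : 0 < l) (hlk : l < k) :
    LinearIndepOn ℂ symmetrized (latticeLabels k l) := by
  classical
  refine LinearIndependent.of_comp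
    (Finsupp.lcomapDomain (Subtype.val : latticeLabels k l → Label) Subtype.val_injective) ?_
  convert! Finsupp.linearIndependent_single_one ℂ (latticeLabels k l) using 1
  ext b b'
  obtain ⟨s, hs⟩ := b.2
  obtain ⟨t, ht⟩ := b'.2
  have : reflect b.1 ≠ b'.1 := fun h => by
    have := congrArg Prod.snd h
    rw [← ht, show (reflect b.1).2 = -b.1.2 from rfl, ← hs] at this
    exact position_ne_neg_position hl hlk t s this.symm
  change symmetrized b.1 b'.1 = _
  rw [symmetrized_eq, Finsupp.add_apply, Finsupp.smul_apply, Finsupp.single_apply,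
    Finsupp.single_apply, Finsupp.single_apply, if_neg this, smul_zero, add_zero]
  simp only [Subtype.ext_iff]

lemma finrank_weightSpace {k l : ℕ} (hl : 0 < l) (hlk : l < k) {w : ℝ × ℝ}
    (hw : (weightLabels k l w).Finite) :
    Module.finrank ℂ (weightSpace k (representation k l) w) = Nat.card (weightLabels k l w) := by
  have := hw.fintype
  have h : LinearIndependent ℂ fun b : weightLabels k l w => symmetrized b :=
    (linearIndepOn_symmetrized hl hlk).mono fun b hb => hb.1
  rw [weightSpace_representation, Set.image_eq_range, finrank_span_eq_card h,
    Nat.card_eq_fintype_card]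

lemma finite_weightSpace {k l : ℕ} {w : ℝ × ℝ} (hw : (weightLabels k l w).Finite) :
    Module.Finite ℂ (weightSpace k (representation k l) w) := by
  rw [weightSpace_representation]
  exact Module.Finite.span_of_finite ℂ (hw.image _)

/-! ### Sums over occupation numbers -/

lemma sum_finsupp_prod {ι : Type*} (x : ι → ℝ) (s : Finset ι) (N : ℕ) :
    ∑ f ∈ s.finsupp fun _ => Finset.range N, (f.prod fun i a => x i ^ a) =
      ∏ i ∈ s, ∑ a ∈ Finset.range N, x i ^ a := by
  classical
  rw [Finset.prod_sum, Finset.finsupp, Finset.sum_map]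
  refine Finset.sum_congr (by congr!) fun p _ => ?_
  change (Finsupp.indicator s p).prod _ = _
  rw [Finsupp.prod_of_support_subset _ (Finsupp.support_indicator_subset _ _) _ (by simp),
    ← Finset.prod_attach]
  refine Finset.prod_congr rfl fun i _ => ?_
  rw [Finsupp.indicator_of_mem i.2]

/-- All terms are nonnegative, so it suffices that `P` is the supremum of finite sums. Any finite
set of occupation numbers fits in a box, where the sum is a product of truncated geometric series;
growing boxes exhaust `P`. -/
lemma hasSum_finsupp_prod {ι : Type*} {x : ι → ℝ} (h0 : ∀ i, 0 ≤ x i) (h1 : ∀ i, x i < 1) {P : ℝ}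
    (hP : HasProd (fun i => (1 - x i)⁻¹) P) :
    HasSum (fun f : ι →₀ ℕ => f.prod fun i a => x i ^ a) P := by
  classical
  have hnonneg : ∀ f : ι →₀ ℕ, 0 ≤ f.prod fun i a => x i ^ a := fun f =>
    Finset.prod_nonneg fun i _ => pow_nonneg (h0 i) _
  have hgeom : ∀ i, HasSum (fun a : ℕ => x i ^ a) (1 - x i)⁻¹ := fun i =>
    hasSum_geometric_of_lt_one (h0 i) (h1 i)
  have htend : Filter.Tendsto (fun s : Finset ι => ∏ i ∈ s, (1 - x i)⁻¹) Filter.atTop (nhds P) := hP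
  have hone : ∀ i, 1 ≤ (1 - x i)⁻¹ := fun i =>
    (one_le_inv₀ (by linarith [h1 i])).mpr (by linarith [h0 i])
  have hmono : Monotone fun s : Finset ι => ∏ i ∈ s, (1 - x i)⁻¹ := by
    intro s t hst
    simp only
    rw [← Finset.prod_sdiff hst]
    exact le_mul_of_one_le_left (Finset.prod_nonneg fun i _ => zero_le_one.trans (hone i))
      (Finset.prod_induction _ (1 ≤ ·) (fun _ _ => one_le_mul_of_one_le_of_one_le) le_rfl
        fun i _ => hone i)
  refine hasSum_of_isLUB_of_nonneg P hnonneg ⟨?_, fun B hB => ?_⟩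
  · rintro _ ⟨T, rfl⟩
    set s := T.biUnion Finsupp.support
    set N := (T.sup fun f => s.sup f) + 1 with hN
    have hT : T ⊆ s.finsupp fun _ => Finset.range N := fun f hf => by
      rw [Finset.mem_finsupp_iff]
      refine ⟨Finset.subset_biUnion_of_mem _ hf, fun i hi => ?_⟩
      rw [Finset.mem_range, hN, Nat.lt_succ_iff]
      exact (Finset.le_sup hi).trans (Finset.le_sup (f := fun f : ι →₀ ℕ => s.sup f) hf)
    refine (Finset.sum_le_sum_of_subset_of_nonneg hT fun f _ _ => hnonneg f).trans ?_
    rw [sum_finsupp_prod]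
    refine (Finset.prod_le_prod (fun i _ => Finset.sum_nonneg fun a _ => pow_nonneg (h0 i) a)
      fun i _ => ?_).trans (hmono.ge_of_tendsto htend s)
    exact sum_le_hasSum _ (fun a _ => pow_nonneg (h0 i) a) (hgeom i)
  · refine le_of_tendsto' htend fun s => ?_
    refine le_of_tendsto' (tendsto_finsetProd s fun i _ => (hgeom i).tendsto_sum_nat) fun N => ?_
    rw [← sum_finsupp_prod]
    exact hB ⟨_, rfl⟩

/-- Two copies of the natural numbers enumerate the creation modes. -/
def modeEquiv : ℕ ⊕ ℕ ≃ Chirality × ℕ+ where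
  toFun := Sum.elim (fun n => (.left, n.succPNat)) fun n => (.right, n.succPNat)
  invFun
    | (.left, n) => .inl n.natPred
    | (.right, n) => .inr n.natPred
  left_inv := by rintro (n | n) <;> simp
  right_inv := by rintro ⟨_ | _, n⟩ <;> simp

/-- The Euler product `∏_{n ≥ 1} (1 - q^n)`. -/
noncomputable def eulerProd (q : ℝ) : ℝ := ∏' n : ℕ, (1 - q ^ (n + 1))

lemma summable_pow_succ {q : ℝ} (h0 : 0 < q) (h1 : q < 1) : Summable fun n : ℕ => -q ^ (n + 1) :=
  ((summable_nat_add_iff 1).mpr (summable_geometric_of_lt_one h0.le h1)).neg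

lemma hasProd_eulerProd {q : ℝ} (h0 : 0 < q) (h1 : q < 1) :
    HasProd (fun n : ℕ => 1 - q ^ (n + 1)) (eulerProd q) := by
  simpa only [← sub_eq_add_neg, eulerProd] using
    (Real.multipliable_one_add_of_summable (summable_pow_succ h0 h1)).hasProd

lemma eulerProd_ne_zero {q : ℝ} (h0 : 0 < q) (h1 : q < 1) : eulerProd q ≠ 0 := by
  have := tprod_one_add_ne_zero_of_summable (f := fun n : ℕ => -q ^ (n + 1)) (fun n => ?_)
    (summable_pow_succ h0 h1).norm
  · simpa only [← sub_eq_add_neg, eulerProd] using this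
  · have := pow_lt_one₀ h0.le h1 (Nat.succ_ne_zero n)
    rw [Nat.succ_eq_add_one] at this
    linarith

lemma hasSum_pow_level {q : ℝ} (h0 : 0 < q) (h1 : q < 1) :
    HasSum (fun f : Chirality × ℕ+ →₀ ℕ => q ^ (level .left f + level .right f))
      ((eulerProd q)⁻¹ ^ 2) := by
  have hP := (hasProd_eulerProd h0 h1).inv₀ (eulerProd_ne_zero h0 h1)
  have hP2 : HasProd (fun i : Chirality × ℕ+ => (1 - q ^ (i.2 : ℕ))⁻¹) ((eulerProd q)⁻¹ ^ 2) := by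
    rw [sq, ← modeEquiv.hasProd_iff]
    exact HasProd.sum (by simpa [Function.comp_def, modeEquiv] using hP)
      (by simpa [Function.comp_def, modeEquiv] using hP)
  convert! hasSum_finsupp_prod (fun i => by positivity)
    (fun i => pow_lt_one₀ h0.le h1 i.2.ne_zero) hP2 using 2 with f
  rw [level, level, ← Finsupp.sum_add, Finsupp.sum, Finsupp.prod, ← Finset.prod_pow_eq_pow_sum]
  refine Finset.prod_congr rfl fun i _ => ?_
  obtain ⟨_ | _, n⟩ := i <;> simp [pow_mul]

/-! ### Theta sums -/

/-- The theta sum `∑_{n ∈ ℤ} q^{k(n + l/2k)²}`. -/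
noncomputable def theta (k l : ℕ) (q : ℝ) : ℝ :=
  ∑' n : ℤ, q ^ ((k : ℝ) * ((n : ℝ) + (l : ℝ) / (2 * (k : ℝ))) ^ 2)

/-- Since `0 ≤ l / 2k ≤ 1 / 2`, the shifted integer has absolute value at least `|n| / 2`, and `n ≤
n ^ 2` gives comparison with a geometric series of ratio `q ^ (1 / 4)`. -/
lemma summable_theta {k l : ℕ} (hl : 0 < l) (hlk : l < k) {q : ℝ} (h0 : 0 < q) (h1 : q < 1) :
    Summable fun n : ℤ => q ^ ((k : ℝ) * ((n : ℝ) + (l : ℝ) / (2 * (k : ℝ))) ^ 2) := by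
  have hk : (1 : ℝ) ≤ k := by exact_mod_cast (hl.trans hlk)
  have hx0 : 0 ≤ (l : ℝ) / (2 * k) := by positivity
  have hx1 : (l : ℝ) / (2 * k) ≤ 1 / 2 := by
    have : (l : ℝ) ≤ k := by exact_mod_cast hlk.le
    rw [div_le_div_iff₀ (by positivity) (by positivity)]
    linarith
  set x := (l : ℝ) / (2 * k)
  have hr0 : 0 ≤ q ^ (1 / 4 : ℝ) := (Real.rpow_pos_of_pos h0 _).le
  have hr1 : q ^ (1 / 4 : ℝ) < 1 := Real.rpow_lt_one h0.le h1 (by norm_num)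
  have hs := summable_geometric_of_lt_one hr0 hr1
  have bound : ∀ (n : ℕ) (y : ℝ), (n : ℝ) / 4 ≤ y → q ^ y ≤ (q ^ (1 / 4 : ℝ)) ^ n := by
    intro n y hy
    rw [← Real.rpow_natCast, ← Real.rpow_mul h0.le]
    exact Real.rpow_le_rpow_of_exponent_ge h0 h1.le (by linarith)
  have hsq : ∀ (n : ℕ) (y : ℝ), ((n : ℝ) / 2) ^ 2 ≤ y ^ 2 → (n : ℝ) / 4 ≤ k * y ^ 2 := by
    intro n y hy
    have hn : (n : ℝ) ≤ (n : ℝ) ^ 2 := by exact_mod_cast Nat.le_self_pow two_ne_zero n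
    have hle : y ^ 2 ≤ k * y ^ 2 := le_mul_of_one_le_left (sq_nonneg y) hk
    nlinarith
  refine Summable.of_nat_of_neg
    (hs.of_nonneg_of_le (fun n => (Real.rpow_pos_of_pos h0 _).le) fun n => bound n _ (hsq n _ ?_))
    (hs.of_nonneg_of_le (fun n => (Real.rpow_pos_of_pos h0 _).le) fun n => bound n _ (hsq n _ ?_))
  · push_cast
    have : (0 : ℝ) ≤ n := n.cast_nonneg
    gcongr
    linarith
  · push_cast
    -- The bound `n - x ≥ n / 2` needs `n ≥ 1`.
    rcases Nat.eq_zero_or_pos n with rfl | hn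
    · simpa using sq_nonneg x
    · have : (1 : ℝ) ≤ n := by exact_mod_cast hn
      rw [← neg_sq (-(n : ℝ) + x)]
      gcongr
      linarith

lemma charge_left_sq_div {k : ℕ} (hk : 0 < k) (l : ℕ) (s : ℤ × ℤ) :
    (charge k .left (position k l s) : ℝ) ^ 2 / (4 * k) =
      k * ((s.1 : ℝ) + (l : ℝ) / (2 * (k : ℝ))) ^ 2 := by
  have : (k : ℝ) ≠ 0 := by exact_mod_cast hk.ne'
  rw [charge_left_position]
  push_cast
  field_simp
  ring

lemma charge_right_sq_div {k : ℕ} (hk : 0 < k) (l : ℕ) (s : ℤ × ℤ) :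
    (charge k .right (position k l s) : ℝ) ^ 2 / (4 * k) =
      k * (((-s.2 : ℤ) : ℝ) + (l : ℝ) / (2 * (k : ℝ))) ^ 2 := by
  have : (k : ℝ) ≠ 0 := by exact_mod_cast hk.ne'
  rw [charge_right_position]
  push_cast
  field_simp
  ring

lemma hasSum_lattice {k l : ℕ} (hl : 0 < l) (hlk : l < k) {q : ℝ} (h0 : 0 < q) (h1 : q < 1) :
    HasSum (fun s : ℤ × ℤ => q ^ ((charge k .left (position k l s) : ℝ) ^ 2 / (4 * k)) *
      q ^ ((charge k .right (position k l s) : ℝ) ^ 2 / (4 * k))) (theta k l q ^ 2) := by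
  simp only [charge_left_sq_div (hl.trans hlk), charge_right_sq_div (hl.trans hlk)]
  have hs := summable_theta hl hlk h0 h1
  have hl' := hs.hasSum
  -- The right charge is `2ks' - l`, so `s' ↦ -s'` turns the right sum into the left one.
  have hr' := ((Equiv.neg ℤ).hasSum_iff).mpr hl'
  rw [sq]
  exact hl'.mul hr' (hl'.summable.mul_of_nonneg hr'.summable
    (fun n => (Real.rpow_pos_of_pos h0 _).le) fun n => (Real.rpow_pos_of_pos h0 _).le)

/-! ### The trace -/

/-- The lattice labels are pairs of occupation numbers and a summand index. -/
noncomputable def latticeEquiv {k : ℕ} (hk : 0 < k) (l : ℕ) :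
    (Chirality × ℕ+ →₀ ℕ) × (ℤ × ℤ) ≃ latticeLabels k l :=
  Equiv.ofBijective (fun p => ⟨(p.1, position k l p.2), p.2, rfl⟩) <| by
    constructor
    · rintro ⟨f, s⟩ ⟨g, t⟩ h
      have h' := congrArg Subtype.val h
      simp only [Prod.mk.injEq] at h'
      exact Prod.ext h'.1 (position_injective hk l h'.2)
    · rintro ⟨⟨f, w⟩, s, hs⟩
      exact ⟨(f, s), Subtype.ext (Prod.ext rfl hs)⟩

lemma chi_sq (k l : ℕ) {q : ℝ} (h0 : 0 < q) : chi k l q ^ 2 =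
    q ^ (-(1 / 12) : ℝ) * ((eulerProd q)⁻¹ ^ 2 * theta k l q ^ 2) := by
  have hchi : chi k l q = theta k l q / (q ^ (1 / 24 : ℝ) * eulerProd q) := tsum_div_const
  have hq : (q ^ (1 / 24 : ℝ)) ^ 2 = q ^ (1 / 12 : ℝ) := by
    rw [← Real.rpow_natCast, ← Real.rpow_mul h0.le]
    norm_num
  rw [hchi, div_pow, mul_pow, hq, Real.rpow_neg h0.le, div_eq_mul_inv, mul_inv, inv_pow]
  ring

lemma hasSum_latticeLabels {k l : ℕ} (hl : 0 < l) (hlk : l < k) {q : ℝ} (h0 : 0 < q)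
    (h1 : q < 1) :
    HasSum (fun b : latticeLabels k l =>
      q ^ (weight k .left b - 1 / 24) * q ^ (weight k .right b - 1 / 24)) (chi k l q ^ 2) := by
  rw [← (latticeEquiv (hl.trans hlk) l).hasSum_iff, chi_sq k l h0]
  have h := hasSum_pow_level h0 h1
  have h' := hasSum_lattice hl hlk h0 h1
  convert! (h.mul h' (h.summable.mul_of_nonneg h'.summable (fun f => by positivity)
    (fun s => by positivity))).mul_left (q ^ (-(1 / 12) : ℝ)) using 2 with p
  obtain ⟨f, s⟩ := p
  change q ^ (weight k .left (f, position k l s) - 1 / 24) *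
    q ^ (weight k .right (f, position k l s) - 1 / 24) = _
  simp only [weight]
  rw [← Real.rpow_natCast q, ← Real.rpow_add h0, ← Real.rpow_add h0, ← Real.rpow_add h0,
    ← Real.rpow_add h0]
  congr 1
  push_cast
  ring

lemma hasTrace_representation {k l : ℕ} (hl : 0 < l) (hlk : l < k) {q : ℝ} (h0 : 0 < q)
    (h1 : q < 1) : HasTrace k (representation k l) q (chi k l q ^ 2) := by
  have h := hasSum_latticeLabels hl hlk h0 h1
  let W : latticeLabels k l → ℝ × ℝ := fun b => (weight k .left b, weight k .right b)
  have hW : ∀ w, ∀ b : W ⁻¹' {w},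
      q ^ (weight k .left b.1 - 1 / 24) * q ^ (weight k .right b.1 - 1 / 24) =
        q ^ (w.1 - 1 / 24) * q ^ (w.2 - 1 / 24) := by
    rintro w ⟨b, rfl⟩
    rfl
  have hlabels : ∀ w, weightLabels k l w = Subtype.val '' (W ⁻¹' {w}) := by
    intro w
    ext b
    constructor
    · rintro ⟨hb, h1, h2⟩
      exact ⟨⟨b, hb⟩, Prod.ext h1 h2, rfl⟩
    · rintro ⟨b, rfl, rfl⟩
      exact ⟨b.2, rfl, rfl⟩
  -- Finite multiplicity comes from convergence: a fixed weight contributes a constant positive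
  -- term, and such a series cannot converge over an infinite set.
  have hfin : ∀ w, (weightLabels k l w).Finite := by
    intro w
    rw [hlabels]
    refine Set.Finite.image _ (Set.not_infinite.mp fun hinf => ?_)
    have := hinf.to_subtype
    have hs' : Summable fun _ : W ⁻¹' {w} => q ^ (w.1 - 1 / 24) * q ^ (w.2 - 1 / 24) :=
      (h.summable.subtype (W ⁻¹' {w})).congr (hW w)
    rw [summable_const_iff] at hs'
    have : 0 < q ^ (w.1 - 1 / 24) * q ^ (w.2 - 1 / 24) := by positivity
    exact this.ne' hs'
  refine ⟨iSup_weightSpace_representation k l, fun w => finite_weightSpace (hfin w), ?_⟩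
  -- Grouping the labels by weight turns the sum over basis vectors into one over eigenvalues with
  -- multiplicity.
  convert! h.tsum_fiberwise W using 2 with w
  rw [finrank_weightSpace hl hlk (hfin w), tsum_congr (hW w), tsum_const, nsmul_eq_mul, hlabels,
    Nat.card_image_of_injective Subtype.val_injective]

end Orbifold

theorem proposition3 (k l : ℕ) (hl : 0 < l) (hlk : l < k) :
    iSupIndep (Orbifold.summand k l) ∧
    Orbifold.generated k (Orbifold.ket 0 (l : ℤ) + Orbifold.ket 0 (-(l : ℤ))) =
      ⨆ s : ℤ × ℤ, Orbifold.summand k l s ∧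
    ∀ q : ℝ, 0 < q → q < 1 →
      Orbifold.HasTrace k (⨆ s : ℤ × ℤ, Orbifold.summand k l s) q (Orbifold.chi k l q ^ 2) := by
  rw [Orbifold.iSup_summand]
  exact ⟨Orbifold.iSupIndep_summand hl hlk, Orbifold.generated_eq_representation hl hlk,
    fun q h0 h1 => Orbifold.hasTrace_representation hl hlk h0 h1⟩
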